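/- Let $n\ge 1$ and let $0<p,q,r\le\infty$ satisfy the Hölder condition $\frac1p+\frac1q=\frac1r$ (with $1/\infty=0$). Suppose that $(p,q,r)$ lies outside the local $L^2$-range, i.e. that $2\le p,q,r'\le\infty$ fails, so that $p<2$, $q<2$ or $r'<2$; here $r'$ is the conjugate exponent of $r$, with $r'=\infty$ if $r\le 1$. For a bounded measurable function $m$ on $\mathbb R^n\times\mathbb R^n$ and Schwartz functions $f,g$ on $\mathbb R^n$ put $$M_m(f,g)(x)=\int_{\mathbb R^n}\int_{\mathbb R^n}\hat f(\xi)\,\hat g(\eta)\,m(\xi,\eta)\,e^{2\pi i x\cdot(\xi+\eta)}\,d\xi\,d\eta,\qquad \hat f(\xi)=\int_{\mathbb R^n} f(x)e^{-2\pi i x\cdot\xi}\,dx,$$ and let $\|m\|_{\mathcal M_{p,q,r}(\mathbb R^n)}\in[0,\infty]$ be the least $C\in[0,\infty]$ such that $\|M_m(f,g)\|_{L^r}\le C\|f\|_{L^p}\|g\|_{L^q}$ for all Schwartz functions $f,g$ (so that it is $\infty$ if $M_m$ is not bounded). Let $\varphi:\mathbb R^n\to\mathbb R$ be a $C^1$ function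 which is non-linear, in the sense that it is not of the form $\varphi(t)=\langle\alpha,t\rangle+\beta$ with $\alpha\in\mathbb R^n$, $\beta\in\mathbb R$. Then $$\big\|e^{i\lambda\varphi(\xi-\eta)}\big\|_{\mathcal M_{p,q,r}(\mathbb R^n)}\longrightarrow\infty\qquad\text{as }|\lambda|\to\infty,\ \lambda\in\mathbb R.$$ -/

import Mathlib

open scoped ENNReal FourierTransform SchwartzMap

noncomputable section

/-- The bilinear operator with symbol `m`, on Schwartz functions:
`M_m(f,g)(x) = ∫∫ f̂(ξ) ĝ(η) m(ξ,η) e^{2πi x·(ξ+η)} dξ dη`, where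
`f̂(ξ) = ∫ f(x) e^{-2πi x·ξ} dx`. -/
def bilinearMultiplierOp {n : ℕ}
    (m : EuclideanSpace ℝ (Fin n) → EuclideanSpace ℝ (Fin n) → ℂ)
    (f g : 𝓢(EuclideanSpace ℝ (Fin n), ℂ)) (x : EuclideanSpace ℝ (Fin n)) : ℂ :=
  ∫ ξ : EuclideanSpace ℝ (Fin n), ∫ η : EuclideanSpace ℝ (Fin n),
    𝓕 (f : EuclideanSpace ℝ (Fin n) → ℂ) ξ * 𝓕 (g : EuclideanSpace ℝ (Fin n) → ℂ) η * m ξ η *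
      Complex.exp (2 * Real.pi * Complex.I * (inner ℝ x (ξ + η) : ℝ))

/-- The bilinear multiplier norm of a bounded measurable symbol `m`: the least `C ∈ [0,∞]` with
`‖M_m(f,g)‖_r ≤ C ‖f‖_p ‖g‖_q` for all Schwartz functions `f, g`. It is `∞` exactly when `m` is not
a bilinear multiplier symbol for `(p,q,r)`. -/
def bilinearMultiplierNorm {n : ℕ} (p q r : ℝ≥0∞)
    (m : EuclideanSpace ℝ (Fin n) → EuclideanSpace ℝ (Fin n) → ℂ) : ℝ≥0∞ :=
  sInf {C : ℝ≥0∞ | ∀ f g : 𝓢(EuclideanSpace ℝ (Fin n), ℂ),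
    MeasureTheory.eLpNorm (bilinearMultiplierOp m f g) r MeasureTheory.volume ≤
      C * MeasureTheory.eLpNorm f p MeasureTheory.volume *
        MeasureTheory.eLpNorm g q MeasureTheory.volume}

/-- The local `L²`-range: Hölder triples with `2 ≤ p, q, r' ≤ ∞`. Here `r'` is the conjugate
exponent, which is `∞` for `r ≤ 1`. -/
def InLocalL2Range (p q r : ℝ≥0∞) : Prop :=
  p⁻¹ + q⁻¹ = r⁻¹ ∧ 2 ≤ p ∧ 2 ≤ q ∧ 2 ≤ ENNReal.conjExponent r

/-- A linear phase, in the sense `φ(t) = ⟨α, t⟩ + β`. -/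
def IsLinearPhase {n : ℕ} (φ : EuclideanSpace ℝ (Fin n) → ℝ) : Prop :=
  ∃ (α : EuclideanSpace ℝ (Fin n)) (β : ℝ), ∀ t, φ t = inner ℝ α t + β

end

open MeasureTheory Filter Topology

noncomputable section

/-! Suppose the norms stay below a finite $K$ along some $|\lambda_k|\to\infty$. Under the Hölder
condition the multiplier norm does not grow under dilation (`bilinearMultiplierNorm_comp_smul_le`),
so $\lambda_k\varphi$ may be viewed at scale $\lambda_k^{-1}$. Around a point $a$ the rescaled
phase, less the constant $\lambda_k\varphi(a)$, converges to its linear part, and $e^{2\pi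
i\langle\tau,\xi-\eta\rangle}$ is the symbol of $(f,g)\mapsto f(\cdot+\tau)\,g(\cdot-\tau)$, with
$\tau$ proportional to $\nabla\varphi(a)$. A non-linear $C^1$ phase has infinitely many gradients,
so for every $N$ a single operator acts, at $N$ different frequencies, nearly as $N$ translations
with well separated shifts (`exists_translationLimit`).

Such operators cannot be uniformly bounded outside the local $L^2$-range. Let $F$ be a bump in the
unit ball. If $p<2$, modulated copies of $F$ are stacked on the ball: with suitable signs their sum
has $L^2$ norm, hence $L^p$ norm, $O(N^{1/2})$. A second input of norm $O(N^{1/q})$ makes the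
outputs $N$ disjoint copies of $F^2$, of norm about $N^{1/r}$. Thus $1/r\le 1/2+1/q$, which
contradicts $p<2$ (`card_rpow_mul_le_of_superposed`).

If $r>2$ the roles are exchanged: disjoint inputs of norms $O(N^{1/p})$, $O(N^{1/q})$ are all
brought onto the ball, where suitable signs give output at least about $N^{1/2}$. Thus $1/2\le
1/p+1/q=1/r$, a contradiction (`card_rpow_mul_le_of_disjoint`). The case $q<2$ follows from $p<2$ by
exchanging $f$ and $g$. -/

/-- The character `x ↦ e^{2πi ⟨b, x⟩}`. -/
def planeWave {n : ℕ} (b x : EuclideanSpace ℝ (Fin n)) : ℂ :=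
  Complex.exp (2 * Real.pi * Complex.I * (inner ℝ b x : ℝ))

/-! ### Symmetries and limits of bilinear multiplier operators -/

section Operator

variable {n : ℕ}

local notation "𝔼" => EuclideanSpace ℝ (Fin n)

lemma norm_planeWave (b x : 𝔼) : ‖planeWave b x‖ = 1 := by
  have : (2 * Real.pi * Complex.I * (inner ℝ b x : ℝ) : ℂ)
      = ((2 * Real.pi * inner ℝ b x : ℝ) : ℂ) * Complex.I := by
    push_cast; ring
  rw [planeWave, this, Complex.norm_exp_ofReal_mul_I]

lemma enorm_planeWave (b x : 𝔼) : ‖planeWave b x‖ₑ = 1 := by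
  rw [← ofReal_norm, norm_planeWave, ENNReal.ofReal_one]

lemma continuous_planeWave {X : Type*} [TopologicalSpace X] {b c : X → 𝔼} (hb : Continuous b)
    (hc : Continuous c) : Continuous fun a => planeWave (b a) (c a) := by
  unfold planeWave
  fun_prop

lemma planeWave_add_right (b x y : 𝔼) :
    planeWave b (x + y) = planeWave b x * planeWave b y := by
  simp only [planeWave, ← Complex.exp_add, inner_add_right]
  push_cast; ring_nf

lemma planeWave_comm (b x : 𝔼) : planeWave b x = planeWave x b := by
  simp only [planeWave, real_inner_comm]

lemma planeWave_add_left (b c x : 𝔼) :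
    planeWave (b + c) x = planeWave b x * planeWave c x := by
  simp only [planeWave_comm _ x, planeWave_add_right]

lemma planeWave_smul (t : ℝ) (b x : 𝔼) : planeWave (t • b) x = planeWave b (t • x) := by
  simp only [planeWave, inner_smul_left, inner_smul_right]
  simp

lemma planeWave_neg_left (b x : 𝔼) : planeWave (-b) x = planeWave b (-x) := by
  simp only [planeWave, inner_neg_left, inner_neg_right]

lemma hasTemperateGrowth_cexp_ofReal_mul_I :
    (fun t : ℝ => Complex.exp (t * Complex.I)).HasTemperateGrowth := by
  have hd : ∀ k : ℕ, iteratedDeriv k (fun t : ℝ => Complex.exp (t * Complex.I)) =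
      fun t : ℝ => Complex.I ^ k * Complex.exp (t * Complex.I) := by
    intro k
    induction k with
    | zero => simp
    | succ k ih =>
      rw [iteratedDeriv_succ, ih]
      funext t
      have h : HasDerivAt (fun t : ℝ => Complex.exp (t * Complex.I))
          (Complex.exp (t * Complex.I) * (1 * Complex.I)) t :=
        ((Complex.ofRealCLM.hasDerivAt (x := t)).mul_const Complex.I).cexp
      rw [(h.const_mul (Complex.I ^ k)).deriv]
      ring
  refine ⟨(Complex.ofRealCLM.contDiff.mul contDiff_const).cexp, fun k => ⟨0, 1, fun t => ?_⟩⟩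
  rw [norm_iteratedFDeriv_eq_norm_iteratedDeriv, hd]
  simp [Complex.norm_exp_ofReal_mul_I]

lemma hasTemperateGrowth_planeWave (b : 𝔼) : (planeWave b).HasTemperateGrowth := by
  have h : planeWave b
      = fun x => Complex.exp (((2 * Real.pi) * inner ℝ b x : ℝ) * Complex.I) := by
    funext x
    simp only [planeWave]
    push_cast; ring_nf
  rw [h]
  exact hasTemperateGrowth_cexp_ofReal_mul_I.comp
    (by fun_prop : (fun x => 2 * Real.pi * inner ℝ b x).HasTemperateGrowth)

/-- The product of a Schwartz function with the character of frequency `b`. -/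
def modulate (b : 𝔼) (f : 𝓢(𝔼, ℂ)) : 𝓢(𝔼, ℂ) :=
  SchwartzMap.smulLeftCLM ℂ (planeWave b) f

lemma modulate_apply (b : 𝔼) (f : 𝓢(𝔼, ℂ)) (x : 𝔼) :
    modulate b f x = planeWave b x * f x := by
  rw [modulate, SchwartzMap.smulLeftCLM_apply_apply (hasTemperateGrowth_planeWave b), smul_eq_mul]

lemma fourier_eq_integral_planeWave (f : 𝔼 → ℂ) (ξ : 𝔼) :
    𝓕 f ξ = ∫ v, planeWave v (-ξ) * f v := by
  rw [Real.fourier_eq']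
  refine integral_congr_ae (Eventually.of_forall fun v => ?_)
  simp only [planeWave, inner_neg_right, smul_eq_mul]
  push_cast; ring_nf

lemma fourierInv_eq_integral_planeWave (f : 𝔼 → ℂ) (x : 𝔼) :
    𝓕⁻ f x = ∫ v, planeWave x v * f v := by
  rw [Real.fourierInv_eq']
  refine integral_congr_ae (Eventually.of_forall fun v => ?_)
  simp only [planeWave, smul_eq_mul, real_inner_comm x v]
  push_cast; ring_nf

lemma fourier_modulate (b : 𝔼) (f : 𝓢(𝔼, ℂ)) (ξ : 𝔼) :
    𝓕 (modulate b f : 𝔼 → ℂ) ξ = 𝓕 (f : 𝔼 → ℂ) (ξ - b) := by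
  simp only [fourier_eq_integral_planeWave, modulate_apply]
  refine integral_congr_ae (Eventually.of_forall fun v => ?_)
  simp only
  rw [neg_sub, sub_eq_add_neg, planeWave_add_right, planeWave_comm v b]
  ring

lemma bilinearMultiplierOp_eq (m : 𝔼 → 𝔼 → ℂ) (f g : 𝓢(𝔼, ℂ)) (x : 𝔼) :
    bilinearMultiplierOp m f g x = ∫ ξ, ∫ η,
      𝓕 (f : 𝔼 → ℂ) ξ * 𝓕 (g : 𝔼 → ℂ) η * m ξ η * planeWave x (ξ + η) := rfl

/-- A continuous bilinear symbol bounded by one. -/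
structure IsContractiveSymbol (m : 𝔼 → 𝔼 → ℂ) : Prop where
  cont : Continuous fun z : 𝔼 × 𝔼 => m z.1 z.2
  bound : ∀ ξ η, ‖m ξ η‖ ≤ 1

lemma integrable_fourier_mul_fourier (f g : 𝓢(𝔼, ℂ)) :
    Integrable fun z : 𝔼 × 𝔼 => 𝓕 (f : 𝔼 → ℂ) z.1 * 𝓕 (g : 𝔼 → ℂ) z.2 :=
  ((𝓕 f : 𝓢(𝔼, ℂ)).integrable (μ := volume)).mul_prod
    ((𝓕 g : 𝓢(𝔼, ℂ)).integrable (μ := volume))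

lemma IsContractiveSymbol.norm_integrand_le {m : 𝔼 → 𝔼 → ℂ} (hm : IsContractiveSymbol m)
    (f g : 𝓢(𝔼, ℂ)) (x : 𝔼) (ξ η : 𝔼) :
    ‖𝓕 (f : 𝔼 → ℂ) ξ * 𝓕 (g : 𝔼 → ℂ) η * m ξ η * planeWave x (ξ + η)‖ ≤
      ‖𝓕 (f : 𝔼 → ℂ) ξ * 𝓕 (g : 𝔼 → ℂ) η‖ := by
  rw [norm_mul, norm_planeWave, mul_one, norm_mul]
  exact mul_le_of_le_one_right (norm_nonneg _) (hm.bound ξ η)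

lemma continuous_fourier_schwartz (f : 𝓢(𝔼, ℂ)) : Continuous (𝓕 (f : 𝔼 → ℂ)) :=
  (𝓕 f : 𝓢(𝔼, ℂ)).continuous

lemma IsContractiveSymbol.continuous_integrand {m : 𝔼 → 𝔼 → ℂ} (hm : IsContractiveSymbol m)
    (f g : 𝓢(𝔼, ℂ)) (x : 𝔼) :
    Continuous fun z : 𝔼 × 𝔼 => 𝓕 (f : 𝔼 → ℂ) z.1 * 𝓕 (g : 𝔼 → ℂ) z.2 * m z.1 z.2 *
      planeWave x (z.1 + z.2) := by
  have h1 := continuous_fourier_schwartz f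
  have h2 := continuous_fourier_schwartz g
  have h3 : Continuous fun z : 𝔼 × 𝔼 => planeWave x (z.1 + z.2) :=
    continuous_planeWave continuous_const (continuous_fst.add continuous_snd)
  exact (((h1.comp continuous_fst).mul (h2.comp continuous_snd)).mul hm.cont).mul h3

lemma IsContractiveSymbol.integrable {m : 𝔼 → 𝔼 → ℂ} (hm : IsContractiveSymbol m)
    (f g : 𝓢(𝔼, ℂ)) (x : 𝔼) :
    Integrable fun z : 𝔼 × 𝔼 => 𝓕 (f : 𝔼 → ℂ) z.1 * 𝓕 (g : 𝔼 → ℂ) z.2 * m z.1 z.2 *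
      planeWave x (z.1 + z.2) :=
  (integrable_fourier_mul_fourier f g).mono (hm.continuous_integrand f g x).aestronglyMeasurable
    (Eventually.of_forall fun z => hm.norm_integrand_le f g x z.1 z.2)

lemma IsContractiveSymbol.op_eq_prod {m : 𝔼 → 𝔼 → ℂ} (hm : IsContractiveSymbol m)
    (f g : 𝓢(𝔼, ℂ)) (x : 𝔼) :
    bilinearMultiplierOp m f g x = ∫ z : 𝔼 × 𝔼,
      𝓕 (f : 𝔼 → ℂ) z.1 * 𝓕 (g : 𝔼 → ℂ) z.2 * m z.1 z.2 * planeWave x (z.1 + z.2) := by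
  rw [bilinearMultiplierOp_eq]
  exact (integral_prod _ (hm.integrable f g x)).symm

lemma IsContractiveSymbol.continuous_op {m : 𝔼 → 𝔼 → ℂ} (hm : IsContractiveSymbol m)
    (f g : 𝓢(𝔼, ℂ)) : Continuous (bilinearMultiplierOp m f g) := by
  have h : bilinearMultiplierOp m f g = fun x => ∫ z : 𝔼 × 𝔼,
      𝓕 (f : 𝔼 → ℂ) z.1 * 𝓕 (g : 𝔼 → ℂ) z.2 * m z.1 z.2 * planeWave x (z.1 + z.2) :=
    funext (hm.op_eq_prod f g)
  rw [h]
  refine continuous_of_dominated (fun x => (hm.continuous_integrand f g x).aestronglyMeasurable)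
    (fun x => Eventually.of_forall fun z => hm.norm_integrand_le f g x z.1 z.2)
    (integrable_fourier_mul_fourier f g).norm (Eventually.of_forall fun z => ?_)
  exact continuous_const.mul (continuous_planeWave continuous_id continuous_const)

lemma IsContractiveSymbol.swap {m : 𝔼 → 𝔼 → ℂ} (hm : IsContractiveSymbol m) :
    IsContractiveSymbol fun ξ η => m η ξ :=
  ⟨hm.cont.comp continuous_swap, fun ξ η => hm.bound η ξ⟩

lemma IsContractiveSymbol.op_swap {m : 𝔼 → 𝔼 → ℂ} (hm : IsContractiveSymbol m)
    (f g : 𝓢(𝔼, ℂ)) :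
    bilinearMultiplierOp (fun ξ η => m η ξ) g f = bilinearMultiplierOp m f g := by
  funext x
  rw [hm.op_eq_prod, hm.swap.op_eq_prod, Measure.volume_eq_prod, ← integral_prod_swap]
  refine integral_congr_ae (Eventually.of_forall fun z => ?_)
  simp only [Prod.fst_swap, Prod.snd_swap, add_comm z.2 z.1]
  ring

lemma IsContractiveSymbol.norm_swap {m : 𝔼 → 𝔼 → ℂ} (hm : IsContractiveSymbol m)
    (p q r : ℝ≥0∞) :
    bilinearMultiplierNorm q p r (fun ξ η => m η ξ) = bilinearMultiplierNorm p q r m := by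
  unfold bilinearMultiplierNorm
  congr 1
  ext C
  simp only [Set.mem_ofPred_eq]
  rw [forall_comm]
  refine forall₂_congr fun f g => ?_
  rw [hm.op_swap, mul_right_comm]

lemma fourier_sum_smul {ι : Type*} (s : Finset ι) (c : ι → ℂ) (f : ι → 𝓢(𝔼, ℂ)) (ξ : 𝔼) :
    𝓕 ((∑ j ∈ s, c j • f j : 𝓢(𝔼, ℂ)) : 𝔼 → ℂ) ξ = ∑ j ∈ s, c j * 𝓕 (f j : 𝔼 → ℂ) ξ := by
  rw [← SchwartzMap.fourier_coe, ← SchwartzMap.fourierTransformCLM_apply ℂ, map_sum]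
  simp [sum_apply, SchwartzMap.fourier_coe]

lemma IsContractiveSymbol.op_sum_smul {m : 𝔼 → 𝔼 → ℂ} (hm : IsContractiveSymbol m)
    {ι : Type*} (s : Finset ι) (c : ι → ℂ) (f : ι → 𝓢(𝔼, ℂ)) (g : 𝓢(𝔼, ℂ)) (x : 𝔼) :
    bilinearMultiplierOp m (∑ j ∈ s, c j • f j) g x =
      ∑ j ∈ s, c j * bilinearMultiplierOp m (f j) g x := by
  simp only [hm.op_eq_prod, ← integral_const_mul]
  rw [← integral_finsetSum _ fun j _ => (hm.integrable (f j) g x).const_mul (c j)]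
  refine integral_congr_ae (Eventually.of_forall fun z => ?_)
  simp only [fourier_sum_smul, Finset.sum_mul]
  exact Finset.sum_congr rfl fun j _ => by ring

/-- This is how one operator is probed near several frequencies at once: each modulated input sees
its own translate of the symbol. -/
lemma bilinearMultiplierOp_modulate (m : 𝔼 → 𝔼 → ℂ) (b : 𝔼) (f g : 𝓢(𝔼, ℂ)) (x : 𝔼) :
    bilinearMultiplierOp m (modulate b f) g x =
      planeWave b x * bilinearMultiplierOp (fun ξ η => m (ξ + b) η) f g x := by
  simp only [bilinearMultiplierOp_eq, fourier_modulate]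
  rw [← integral_add_right_eq_self _ b, ← integral_const_mul]
  refine integral_congr_ae (Eventually.of_forall fun ξ => ?_)
  simp only [add_sub_cancel_right]
  rw [← integral_const_mul]
  refine integral_congr_ae (Eventually.of_forall fun η => ?_)
  simp only
  rw [show ξ + b + η = b + (ξ + η) by abel, planeWave_add_right, planeWave_comm x b]
  ring

/-- Pointwise convergence of the symbols suffices, since $|\hat f(\xi)\hat g(\eta)|$ is an
integrable majorant. -/
lemma tendsto_bilinearMultiplierOp {M : ℕ → 𝔼 → 𝔼 → ℂ} {m : 𝔼 → 𝔼 → ℂ}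
    (hM : ∀ k, IsContractiveSymbol (M k)) (hm : IsContractiveSymbol m)
    (hlim : ∀ ξ η, Tendsto (fun k => M k ξ η) atTop (𝓝 (m ξ η)))
    (f g : 𝓢(𝔼, ℂ)) (x : 𝔼) :
    Tendsto (fun k => bilinearMultiplierOp (M k) f g x) atTop
      (𝓝 (bilinearMultiplierOp m f g x)) := by
  simp only [hm.op_eq_prod, (hM _).op_eq_prod]
  refine tendsto_integral_of_dominated_convergence _
    (fun k => ((hM k).continuous_integrand f g x).aestronglyMeasurable)
    (integrable_fourier_mul_fourier f g).norm
    (fun k => Eventually.of_forall fun z => (hM k).norm_integrand_le f g x z.1 z.2)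
    (Eventually.of_forall fun z => ?_)
  exact ((hlim z.1 z.2).const_mul _).mul_const _

lemma integral_planeWave_mul_fourier (f : 𝓢(𝔼, ℂ)) (x : 𝔼) :
    ∫ ξ, planeWave x ξ * 𝓕 (f : 𝔼 → ℂ) ξ = f x := by
  rw [← fourierInv_eq_integral_planeWave, f.continuous.fourierInv_fourier_eq f.integrable
    (𝓕 f : 𝓢(𝔼, ℂ)).integrable]

/-- The symbol factors into a character of $\xi$ and one of $\eta$, so Fourier inversion applies to
each variable. -/
lemma bilinearMultiplierOp_shift (τ : 𝔼) (f g : 𝓢(𝔼, ℂ)) (x : 𝔼) :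
    bilinearMultiplierOp (fun ξ η => planeWave τ (ξ - η)) f g x = f (x + τ) * g (x - τ) := by
  rw [bilinearMultiplierOp_eq, ← integral_planeWave_mul_fourier f,
    ← integral_planeWave_mul_fourier g, ← integral_mul_const]
  refine integral_congr_ae (Eventually.of_forall fun ξ => ?_)
  simp only
  rw [← integral_const_mul]
  refine integral_congr_ae (Eventually.of_forall fun η => ?_)
  simp only [sub_eq_add_neg, planeWave_add_right, planeWave_add_left, planeWave_neg_left]
  ring

lemma isContractiveSymbol_shift (τ : 𝔼) :
    IsContractiveSymbol fun ξ η : 𝔼 => planeWave τ (ξ - η) :=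
  ⟨continuous_planeWave continuous_const (continuous_fst.sub continuous_snd),
    fun ξ η => (norm_planeWave τ (ξ - η)).le⟩

lemma IsContractiveSymbol.const_mul_translate {m : 𝔼 → 𝔼 → ℂ} (hm : IsContractiveSymbol m)
    {c : ℂ} (hc : ‖c‖ = 1) (b : 𝔼) : IsContractiveSymbol fun ξ η => c * m (ξ + b) η := by
  refine ⟨continuous_const.mul (hm.cont.comp
    ((continuous_fst.add continuous_const).prodMk continuous_snd)), fun ξ η => ?_⟩
  rw [norm_mul, hc, one_mul]
  exact hm.bound _ _

lemma bilinearMultiplierOp_const_mul (c : ℂ) (m : 𝔼 → 𝔼 → ℂ) (f g : 𝓢(𝔼, ℂ)) (x : 𝔼) :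
    bilinearMultiplierOp (fun ξ η => c * m ξ η) f g x = c * bilinearMultiplierOp m f g x := by
  simp only [bilinearMultiplierOp_eq, ← integral_const_mul]
  refine integral_congr_ae (Eventually.of_forall fun ξ => ?_)
  refine integral_congr_ae (Eventually.of_forall fun η => ?_)
  simp only
  ring

/-- The dilate `x ↦ f (t x)` of a Schwartz function. -/
def dilate (t : ℝ) (ht : t ≠ 0) (f : 𝓢(𝔼, ℂ)) : 𝓢(𝔼, ℂ) :=
  SchwartzMap.compCLMOfContinuousLinearEquiv ℂ
    (ContinuousLinearEquiv.smulLeft (Units.mk0 t ht) : 𝔼 ≃L[ℝ] 𝔼) f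

lemma dilate_apply (t : ℝ) (ht : t ≠ 0) (f : 𝓢(𝔼, ℂ)) (x : 𝔼) :
    dilate t ht f x = f (t • x) := by
  simp [dilate, Units.smul_def]

lemma fourier_dilate (t : ℝ) (ht : t ≠ 0) (f : 𝓢(𝔼, ℂ)) (ξ : 𝔼) :
    𝓕 (dilate t ht f : 𝔼 → ℂ) (t • ξ) = |(t ^ n)⁻¹| • 𝓕 (f : 𝔼 → ℂ) ξ := by
  have h := Measure.integral_comp_smul (volume : Measure 𝔼) (fun v => planeWave v (-ξ) * f v) t
  rw [finrank_euclideanSpace_fin] at h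
  rw [fourier_eq_integral_planeWave, fourier_eq_integral_planeWave, ← h]
  refine integral_congr_ae (Eventually.of_forall fun v => ?_)
  simp only [dilate_apply, planeWave_smul, smul_neg]

lemma bilinearMultiplierOp_dilate (m : 𝔼 → 𝔼 → ℂ) (t : ℝ) (ht : t ≠ 0) (f g : 𝓢(𝔼, ℂ)) (x : 𝔼) :
    bilinearMultiplierOp m (dilate t ht f) (dilate t ht g) x =
      bilinearMultiplierOp (fun ξ η => m (t • ξ) (t • η)) f g (t • x) := by
  have hc (u : 𝔼 → ℂ) : ∫ ξ, u ξ = |t ^ n| • ∫ ξ, u (t • ξ) := by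
    rw [Measure.integral_comp_smul, finrank_euclideanSpace_fin, smul_smul, ← abs_mul,
      mul_inv_cancel₀ (pow_ne_zero _ ht), abs_one, one_smul]
  have hn : ((|t ^ n| : ℝ) : ℂ) * (|(t ^ n)⁻¹| : ℝ) = 1 := by
    rw [← Complex.ofReal_mul, ← abs_mul, mul_inv_cancel₀ (pow_ne_zero _ ht), abs_one,
      Complex.ofReal_one]
  simp only [bilinearMultiplierOp_eq]
  rw [hc, ← integral_smul]
  refine integral_congr_ae (Eventually.of_forall fun ξ => ?_)
  simp only
  rw [hc, ← integral_smul, ← integral_smul]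
  refine integral_congr_ae (Eventually.of_forall fun η => ?_)
  simp only [fourier_dilate, planeWave_smul, smul_add, Complex.real_smul]
  -- The two Jacobians and the two Fourier scalings give $X^2$ with $X=|t^n|\,|t^{-n}|=1$; the
  -- coefficient comes from $X^2-1=(X+1)(X-1)$.
  linear_combination (𝓕 (f : 𝔼 → ℂ) ξ * 𝓕 (g : 𝔼 → ℂ) η * m (t • ξ) (t • η) *
    planeWave x (t • ξ + t • η)) * (((|t ^ n| : ℝ) : ℂ) * (|(t ^ n)⁻¹| : ℝ) + 1) * hn

lemma eLpNorm_comp_smul (t : ℝ) (ht : t ≠ 0) (u : 𝔼 → ℂ) (hu : Continuous u) (p : ℝ≥0∞) :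
    eLpNorm (fun x => u (t • x)) p volume =
      ENNReal.ofReal |(t ^ n)⁻¹| ^ (p⁻¹).toReal * eLpNorm u p volume := by
  have h : eLpNorm (fun x => u (t • x)) p volume =
      eLpNorm u p (Measure.map (t • ·) (volume : Measure 𝔼)) := by
    rw [eLpNorm_map_measure hu.aestronglyMeasurable (by fun_prop)]
    rfl
  rw [h, Measure.map_addHaar_smul _ ht, finrank_euclideanSpace_fin,
    eLpNorm_smul_measure_of_ne_zero (by simp [ht]), one_div, smul_eq_mul]

/-- Dilating both inputs scales the two sides by $A^{1/r}$ and $A^{1/p+1/q}$ with $A=|t|^{-n}$,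
which agree by the Hölder condition. -/
lemma bilinearMultiplierNorm_comp_smul_le {p q r : ℝ≥0∞} (hp : 0 < p) (hq : 0 < q)
    (hpqr : p⁻¹ + q⁻¹ = r⁻¹) {m : 𝔼 → 𝔼 → ℂ}
    (t : ℝ) (ht : t ≠ 0) (hm : IsContractiveSymbol fun ξ η => m (t • ξ) (t • η)) :
    bilinearMultiplierNorm p q r (fun ξ η => m (t • ξ) (t • η)) ≤
      bilinearMultiplierNorm p q r m := by
  refine sInf_le_sInf fun C hC f g => ?_
  have h := hC (dilate t ht f) (dilate t ht g)
  have h1 : bilinearMultiplierOp m (dilate t ht f) (dilate t ht g) = fun x =>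
      bilinearMultiplierOp (fun ξ η => m (t • ξ) (t • η)) f g (t • x) :=
    funext (bilinearMultiplierOp_dilate m t ht f g)
  have h2 (f : 𝓢(𝔼, ℂ)) : (dilate t ht f : 𝔼 → ℂ) = fun x => f (t • x) :=
    funext (dilate_apply t ht f)
  rw [h1, h2, h2, eLpNorm_comp_smul t ht _ (hm.continuous_op f g),
    eLpNorm_comp_smul t ht _ f.continuous, eLpNorm_comp_smul t ht _ g.continuous] at h
  set A := ENNReal.ofReal |(t ^ n)⁻¹| with hA
  have hA0 : A ≠ 0 := by simp [hA, ht]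
  have hAt : A ≠ ∞ := ENNReal.ofReal_ne_top
  have hexp : A ^ (r⁻¹).toReal = A ^ (p⁻¹).toReal * A ^ (q⁻¹).toReal := by
    rw [← ENNReal.rpow_add _ _ hA0 hAt, ← hpqr, ENNReal.toReal_add (by simpa using hp.ne')
      (by simpa using hq.ne')]
  rw [hexp] at h
  refine (ENNReal.mul_le_mul_iff_right
    (a := A ^ (p⁻¹).toReal * A ^ (q⁻¹).toReal) ?_ ?_).1 (h.trans_eq (by ring))
  · simp [hA0, hAt]
  · exact ENNReal.mul_ne_top (ENNReal.rpow_ne_top_of_ne_zero hA0 hAt)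
      (ENNReal.rpow_ne_top_of_ne_zero hA0 hAt)

lemma eLpNorm_schwartz_ne_top (f : 𝓢(𝔼, ℂ)) (p : ℝ≥0∞) :
    eLpNorm (f : 𝔼 → ℂ) p volume ≠ ∞ := by
  have h : MemLp (f : 𝔼 → ℂ) p volume := f.memLp p volume
  exact h.2.ne

/-- The infimum defining the norm is itself admissible. Finiteness supplies a constant for the
degenerate case in which division by the norms is not possible. -/
lemma eLpNorm_op_le {p q r : ℝ≥0∞} {m : 𝔼 → 𝔼 → ℂ} (hm : bilinearMultiplierNorm p q r m ≠ ∞)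
    (f g : 𝓢(𝔼, ℂ)) :
    eLpNorm (bilinearMultiplierOp m f g) r volume ≤
      bilinearMultiplierNorm p q r m * (eLpNorm f p volume * eLpNorm g q volume) := by
  have ht : eLpNorm f p volume * eLpNorm g q volume ≠ ∞ :=
    ENNReal.mul_ne_top (eLpNorm_schwartz_ne_top f p) (eLpNorm_schwartz_ne_top g q)
  rcases eq_or_ne (eLpNorm f p volume * eLpNorm g q volume) 0 with h0 | h0
  · obtain ⟨C, hC, -⟩ := sInf_lt_iff.1 hm.lt_top
    have := hC f g
    rw [mul_assoc, h0, mul_zero] at this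
    exact this.trans zero_le
  · rw [← ENNReal.div_le_iff h0 ht]
    refine le_sInf fun C hC => ?_
    rw [ENNReal.div_le_iff h0 ht, ← mul_assoc]
    exact hC f g

end Operator

/-! ### Random-sign estimates and disjoint sums in Lebesgue spaces -/

section LebesgueNorms

variable {α ι : Type*} [MeasurableSpace α] {μ : Measure α}

lemma enorm_add_sq_add_enorm_sub_sq (a b : ℂ) :
    ‖a + b‖ₑ ^ 2 + ‖a - b‖ₑ ^ 2 = (‖a‖ₑ ^ 2 + ‖b‖ₑ ^ 2) + (‖a‖ₑ ^ 2 + ‖b‖ₑ ^ 2) := by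
  have h (z : ℂ) : ‖z‖ₑ ^ 2 = ENNReal.ofReal (‖z‖ ^ 2) := by
    rw [ENNReal.ofReal_pow (norm_nonneg _), ofReal_norm]
  simp only [h]
  rw [← ENNReal.ofReal_add (by positivity) (by positivity),
    ← ENNReal.ofReal_add (by positivity) (by positivity),
    ← ENNReal.ofReal_add (by positivity) (by positivity)]
  congr 1
  linarith [parallelogram_law_with_norm ℝ a b]

lemma lintegral_parallelogram {f g : α → ℂ} (hf : AEStronglyMeasurable f μ)
    (hg : AEStronglyMeasurable g μ) :
    ∫⁻ x, ‖f x + g x‖ₑ ^ 2 ∂μ + ∫⁻ x, ‖f x - g x‖ₑ ^ 2 ∂μ =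
      (∫⁻ x, ‖f x‖ₑ ^ 2 ∂μ + ∫⁻ x, ‖g x‖ₑ ^ 2 ∂μ) +
        (∫⁻ x, ‖f x‖ₑ ^ 2 ∂μ + ∫⁻ x, ‖g x‖ₑ ^ 2 ∂μ) := by
  have h1 : AEMeasurable (fun x => ‖f x‖ₑ ^ 2) μ := hf.enorm.pow_const 2
  have h2 : AEMeasurable (fun x => ‖f x + g x‖ₑ ^ 2) μ := (hf.add hg).enorm.pow_const 2
  have h3 : AEMeasurable (fun x => ‖f x‖ₑ ^ 2 + ‖g x‖ₑ ^ 2) μ := h1.add (hg.enorm.pow_const 2)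
  rw [← lintegral_add_left' h2, ← lintegral_add_left' h1,
    ← lintegral_add_left' h3]
  exact lintegral_congr fun x => enorm_add_sq_add_enorm_sub_sq _ _

/-- Unimodular coefficients keeping the `L²` norm of a sum below its orthogonal value. -/
lemma exists_unimodular_lintegral_sum_le (s : Finset ι) {v : ι → α → ℂ}
    (hv : ∀ j, AEStronglyMeasurable (v j) μ) :
    ∃ ε : ι → ℂ, (∀ j, ‖ε j‖ = 1) ∧
      ∫⁻ x, ‖∑ j ∈ s, ε j * v j x‖ₑ ^ 2 ∂μ ≤ ∑ j ∈ s, ∫⁻ x, ‖v j x‖ₑ ^ 2 ∂μ := by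
  classical
  induction s using Finset.induction_on with
  | empty => exact ⟨fun _ => 1, by simp⟩
  | insert a s ha ih =>
    obtain ⟨ε, hε, hle⟩ := ih
    have hS : AEStronglyMeasurable (fun x => ∑ j ∈ s, ε j * v j x) μ :=
      Finset.aestronglyMeasurable_fun_sum s fun j _ => (hv j).const_mul (ε j)
    have key : ∃ c : ℂ, ‖c‖ = 1 ∧ ∫⁻ x, ‖∑ j ∈ s, ε j * v j x + c * v a x‖ₑ ^ 2 ∂μ ≤
        ∫⁻ x, ‖∑ j ∈ s, ε j * v j x‖ₑ ^ 2 ∂μ + ∫⁻ x, ‖v a x‖ₑ ^ 2 ∂μ := by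
      -- By the parallelogram law the two signs $\pm1$ average to the orthogonal value, so they
      -- cannot both exceed it.
      by_contra! hcon
      have h1 := hcon 1 (by simp)
      have h2 := hcon (-1) (by simp)
      simp only [one_mul, neg_mul, ← sub_eq_add_neg] at h1 h2
      exact (ENNReal.add_lt_add h1 h2).ne' (lintegral_parallelogram hS (hv a))
    obtain ⟨c, hc, hcle⟩ := key
    have hsum (x : α) : ∑ j ∈ insert a s, Function.update ε a c j * v j x =
        ∑ j ∈ s, ε j * v j x + c * v a x := by
      rw [Finset.sum_insert ha, add_comm, Function.update_self]
      congr 1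
      refine Finset.sum_congr rfl fun j hj => ?_
      rw [Function.update_of_ne (ne_of_mem_of_not_mem hj ha)]
    refine ⟨Function.update ε a c, fun j => ?_, ?_⟩
    · rcases eq_or_ne j a with rfl | h
      · rwa [Function.update_self]
      · rw [Function.update_of_ne h, hε]
    · simp only [hsum]
      rw [Finset.sum_insert ha, add_comm (∫⁻ x, ‖v a x‖ₑ ^ 2 ∂μ)]
      exact hcle.trans (by gcongr)

/-- Unimodular coefficients keeping the `L²` norm of a sum above its orthogonal value. -/
lemma exists_unimodular_le_lintegral_sum (s : Finset ι) {v : ι → α → ℂ}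
    (hv : ∀ j, AEStronglyMeasurable (v j) μ) :
    ∃ ε : ι → ℂ, (∀ j, ‖ε j‖ = 1) ∧
      ∑ j ∈ s, ∫⁻ x, ‖v j x‖ₑ ^ 2 ∂μ ≤ ∫⁻ x, ‖∑ j ∈ s, ε j * v j x‖ₑ ^ 2 ∂μ := by
  classical
  induction s using Finset.induction_on with
  | empty => exact ⟨fun _ => 1, by simp⟩
  | insert a s ha ih =>
    obtain ⟨ε, hε, hle⟩ := ih
    have hS : AEStronglyMeasurable (fun x => ∑ j ∈ s, ε j * v j x) μ :=
      Finset.aestronglyMeasurable_fun_sum s fun j _ => (hv j).const_mul (ε j)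
    have key : ∃ c : ℂ, ‖c‖ = 1 ∧
        ∫⁻ x, ‖∑ j ∈ s, ε j * v j x‖ₑ ^ 2 ∂μ + ∫⁻ x, ‖v a x‖ₑ ^ 2 ∂μ ≤
          ∫⁻ x, ‖∑ j ∈ s, ε j * v j x + c * v a x‖ₑ ^ 2 ∂μ := by
      by_contra! hcon
      have h1 := hcon 1 (by simp)
      have h2 := hcon (-1) (by simp)
      simp only [one_mul, neg_mul, ← sub_eq_add_neg] at h1 h2
      exact (ENNReal.add_lt_add h1 h2).ne (lintegral_parallelogram hS (hv a))
    obtain ⟨c, hc, hcle⟩ := key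
    have hsum (x : α) : ∑ j ∈ insert a s, Function.update ε a c j * v j x =
        ∑ j ∈ s, ε j * v j x + c * v a x := by
      rw [Finset.sum_insert ha, add_comm, Function.update_self]
      congr 1
      refine Finset.sum_congr rfl fun j hj => ?_
      rw [Function.update_of_ne (ne_of_mem_of_not_mem hj ha)]
    refine ⟨Function.update ε a c, fun j => ?_, ?_⟩
    · rcases eq_or_ne j a with rfl | h
      · rwa [Function.update_self]
      · rw [Function.update_of_ne h, hε]
    · simp only [hsum]
      rw [Finset.sum_insert ha, add_comm (∫⁻ x, ‖v a x‖ₑ ^ 2 ∂μ)]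
      exact le_trans (by gcongr) hcle

lemma eLpNorm_two_sq (f : α → ℂ) : eLpNorm f 2 μ ^ 2 = ∫⁻ x, ‖f x‖ₑ ^ 2 ∂μ := by
  have h := eLpNorm_nnreal_pow_eq_lintegral (μ := μ) (f := f) (p := 2) two_ne_zero
  simpa [ENNReal.rpow_two] using h

lemma apply_sum_of_disjoint {M N : Type*} [AddCommMonoid M] [AddCommMonoid N] [Fintype ι]
    (φ : M → N) (h0 : φ 0 = 0) {a : ι → M} (ha : ∀ i j, i ≠ j → a i = 0 ∨ a j = 0) :
    φ (∑ j, a j) = ∑ j, φ (a j) := by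
  by_cases h : ∃ i, a i ≠ 0
  · obtain ⟨i, hi⟩ := h
    have hz : ∀ j, j ≠ i → a j = 0 := fun j hj => (ha j i hj).resolve_right hi
    rw [Finset.sum_eq_single i (fun j _ hj => hz j hj) (by simp),
      Finset.sum_eq_single i (fun j _ hj => by rw [hz j hj, h0]) (by simp)]
  · push Not at h
    simp [h, h0]

lemma eLpNorm_sum_eq_of_disjoint [Fintype ι] {h : ι → α → ℂ} {p : ℝ≥0∞} (hp : p ≠ 0) (hp' : p ≠ ∞)
    (hm : ∀ j, AEStronglyMeasurable (h j) μ) (hd : ∀ i j, i ≠ j → ∀ x, h i x = 0 ∨ h j x = 0)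
    {A : ℝ≥0∞} (hA : ∀ j, eLpNorm (h j) p μ = A) :
    eLpNorm (fun x => ∑ j, h j x) p μ = (Fintype.card ι : ℝ≥0∞) ^ (p⁻¹).toReal * A := by
  have hpos : 0 < p.toReal := ENNReal.toReal_pos hp hp'
  have hA' (j : ι) : ∫⁻ x, ‖h j x‖ₑ ^ p.toReal ∂μ = A ^ p.toReal := by
    rw [← hA j, eLpNorm_eq_lintegral_rpow_enorm_toReal hp hp', ← ENNReal.rpow_mul,
      one_div_mul_cancel hpos.ne', ENNReal.rpow_one]
  have hpt (x : α) : ‖∑ j, h j x‖ₑ ^ p.toReal = ∑ j, ‖h j x‖ₑ ^ p.toReal :=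
    apply_sum_of_disjoint (fun z : ℂ => ‖z‖ₑ ^ p.toReal) (by simp [hpos]) fun i j hij => hd i j hij x
  rw [eLpNorm_eq_lintegral_rpow_enorm_toReal hp hp']
  simp only [hpt]
  rw [lintegral_finsetSum' _ fun j _ => (hm j).enorm.pow_const _]
  simp only [hA', Finset.sum_const, Finset.card_univ, nsmul_eq_mul]
  rw [ENNReal.mul_rpow_of_nonneg _ _ (by positivity), ← ENNReal.rpow_mul,
    mul_one_div_cancel hpos.ne', ENNReal.rpow_one, ENNReal.toReal_inv, one_div]

/-- At $p=\infty$ the factor is $N^0=1$ even for an empty family, where $A$ is arbitrary; hence only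
an inequality. -/
lemma eLpNorm_sum_le_of_disjoint [Fintype ι] {h : ι → α → ℂ} {p : ℝ≥0∞} (hp : p ≠ 0)
    (hm : ∀ j, AEStronglyMeasurable (h j) μ) (hd : ∀ i j, i ≠ j → ∀ x, h i x = 0 ∨ h j x = 0)
    {A : ℝ≥0∞} (hA : ∀ j, eLpNorm (h j) p μ = A) :
    eLpNorm (fun x => ∑ j, h j x) p μ ≤ (Fintype.card ι : ℝ≥0∞) ^ (p⁻¹).toReal * A := by
  rcases eq_or_ne p ∞ with rfl | hp'
  · simp only [eLpNorm_exponent_top, ENNReal.inv_top, ENNReal.toReal_zero, ENNReal.rpow_zero,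
      one_mul] at hA ⊢
    refine eLpNormEssSup_le_of_ae_enorm_bound ?_
    have hb : ∀ᵐ x ∂μ, ∀ j, ‖h j x‖ₑ ≤ A := by
      rw [ae_all_iff]
      intro j
      rw [← hA j]
      exact enorm_ae_le_eLpNormEssSup _ _
    filter_upwards [hb] with x hx
    by_cases hz : ∃ i, h i x ≠ 0
    · obtain ⟨i, hi⟩ := hz
      rw [Finset.sum_eq_single i (fun j _ hj => (hd j i hj x).resolve_right hi) (by simp)]
      exact hx i
    · push Not at hz
      simp [hz]
  · exact (eLpNorm_sum_eq_of_disjoint hp hp' hm hd hA).le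

lemma false_of_natCast_rpow_le {a b : ℝ} (hab : b < a) {A B : ℝ≥0∞} (hA : A ≠ 0) (hB : B ≠ ∞)
    (h : ∀ N : ℕ, 0 < N → (N : ℝ≥0∞) ^ a * A ≤ B * (N : ℝ≥0∞) ^ b) : False := by
  have hlim : Tendsto (fun N : ℕ => (N : ℝ≥0∞) ^ (a - b)) atTop (𝓝 ∞) :=
    (ENNReal.tendsto_rpow_at_top (sub_pos.2 hab)).comp ENNReal.tendsto_nat_nhds_top
  -- The hypothesis at $N=1$ reads $A\le B$.
  have hAt : A ≠ ∞ := by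
    rintro rfl
    have := h 1 one_pos
    simp [hB] at this
  have hbd : ∀ᶠ N : ℕ in atTop, (N : ℝ≥0∞) ^ (a - b) ≤ B / A := by
    filter_upwards [eventually_gt_atTop 0] with N hN
    have hN0 : (N : ℝ≥0∞) ≠ 0 := by exact_mod_cast hN.ne'
    have hNt : (N : ℝ≥0∞) ≠ ∞ := ENNReal.natCast_ne_top N
    rw [ENNReal.le_div_iff_mul_le (Or.inl hA) (Or.inl hAt)]
    refine (ENNReal.mul_le_mul_iff_left (c := (N : ℝ≥0∞) ^ b)
      (by simp [hN0, hNt]) (ENNReal.rpow_ne_top_of_ne_zero hN0 hNt)).1 ?_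
    refine le_trans (le_of_eq ?_) (h N hN)
    rw [mul_right_comm, ← ENNReal.rpow_add _ _ hN0 hNt, sub_add_cancel]
  have hfin : B / A < ∞ := ENNReal.div_lt_top hB hA
  obtain ⟨N, hN1, hN2⟩ := (hbd.and (hlim.eventually (lt_mem_nhds hfin))).exists
  exact absurd hN2 hN1.not_gt

end LebesgueNorms

/-! ### Gradients of the phase and the test bump -/

section Phase

variable {n : ℕ}

local notation "𝔼" => EuclideanSpace ℝ (Fin n)

lemma isLinearPhase_of_gradient_eq {φ : 𝔼 → ℝ} (hφ : ContDiff ℝ 1 φ)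
    (h : ∀ x y, gradient φ x = gradient φ y) : IsLinearPhase φ := by
  have hd : Differentiable ℝ φ := hφ.differentiable one_ne_zero
  refine ⟨gradient φ 0, φ 0, fun t => ?_⟩
  have hconst := is_const_of_fderiv_eq_zero (𝕜 := ℝ)
    (f := fun x => φ x - inner ℝ (gradient φ 0) x) (hd.sub (innerSL ℝ (gradient φ 0)).differentiable)
    (fun x => ?_) t 0
  · simp only [inner_zero_right, sub_zero] at hconst
    linarith
  · have h1 : HasFDerivAt φ (innerSL ℝ (gradient φ 0)) x := by
      rw [h 0 x]
      exact (hd x).hasGradientAt.hasFDerivAt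
    have h2 := h1.sub (innerSL ℝ (gradient φ 0)).hasFDerivAt
    rw [sub_self] at h2
    exact h2.fderiv

/-- The range of the continuous gradient is connected, and it has two points because the phase is
non-linear; such a set is infinite. -/
lemma exists_injective_gradient {φ : 𝔼 → ℝ} (hφ : ContDiff ℝ 1 φ) (hnl : ¬ IsLinearPhase φ)
    (N : ℕ) : ∃ a : Fin N → 𝔼, Function.Injective fun j => gradient φ (a j) := by
  have hcont : Continuous (gradient φ) :=
    (InnerProductSpace.toDual ℝ 𝔼).symm.continuous.comp (hφ.continuous_fderiv one_ne_zero)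
  have hinf : (Set.range (gradient φ)).Infinite := by
    refine (isPreconnected_range hcont).infinite_of_nontrivial ?_
    rw [← Set.not_subsingleton_iff]
    exact fun hs => hnl (isLinearPhase_of_gradient_eq hφ fun x y => hs ⟨x, rfl⟩ ⟨y, rfl⟩)
  have emb := hinf.natEmbedding
  choose a ha using fun j : Fin N => (emb j).2
  refine ⟨a, fun i j hij => ?_⟩
  simp only [ha] at hij
  exact Fin.ext (emb.injective (Subtype.ext hij))

/-- A dilation separating finitely many distinct vectors. -/
lemma exists_separating_dilation {N : ℕ} {v : Fin N → 𝔼} (hv : Function.Injective v) :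
    ∃ s : ℝ, 0 < s ∧ ∀ i j, i ≠ j → 2 ≤ ‖s • v i - s • v j‖ := by
  have h (i j : Fin N) : ∀ᶠ s : ℝ in atTop, i ≠ j → 2 ≤ ‖s • v i - s • v j‖ := by
    rcases eq_or_ne i j with hij | hij
    · exact Eventually.of_forall fun s hs => absurd hij hs
    · have hpos : 0 < ‖v i - v j‖ := norm_pos_iff.2 (sub_ne_zero.2 (hv.ne hij))
      filter_upwards [eventually_ge_atTop (2 / ‖v i - v j‖), eventually_gt_atTop 0] with s hs h0 _
      rw [← smul_sub, norm_smul, Real.norm_of_nonneg h0.le]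
      exact (div_le_iff₀ hpos).1 hs
  obtain ⟨s, h0, hs⟩ := ((eventually_gt_atTop (0 : ℝ)).and
    (eventually_all.2 fun i => eventually_all.2 fun j => h i j)).exists
  exact ⟨s, h0, hs⟩

/-- A Schwartz function supported in the unit ball and not vanishing at the origin. -/
lemma exists_schwartz_bump : ∃ F : 𝓢(𝔼, ℂ),
    (∀ x, 1 ≤ ‖x‖ → F x = 0) ∧ F 0 ≠ 0 := by
  let B : ContDiffBump (0 : 𝔼) := ⟨1 / 2, 1, by norm_num, by norm_num⟩
  have h1 : HasCompactSupport fun x => (B x : ℂ) :=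
    B.hasCompactSupport.comp_left Complex.ofReal_zero
  have h2 : ContDiff ℝ ((⊤ : ℕ∞) : WithTop ℕ∞) fun x => (B x : ℂ) :=
    Complex.ofRealCLM.contDiff.comp B.contDiff
  refine ⟨h1.toSchwartzMap h2, fun x hx => ?_, ?_⟩
  · change ((B x : ℝ) : ℂ) = 0
    rw [B.zero_of_le_dist (by simpa [B] using hx), Complex.ofReal_zero]
  · change ((B 0 : ℝ) : ℂ) ≠ 0
    rw [B.one_of_mem_closedBall (Metric.mem_closedBall_self B.rIn_pos.le)]
    simp

end Phase

/-! ### Operators imitating many translations, and the exponents they allow -/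

section Core

variable {n : ℕ}

local notation "𝔼" => EuclideanSpace ℝ (Fin n)

/-- The translate `x ↦ f (x + a)` of a Schwartz function. -/
def translateSchwartz (a : 𝔼) (f : 𝓢(𝔼, ℂ)) : 𝓢(𝔼, ℂ) := SchwartzMap.compSubConstCLM ℂ (-a) f

lemma translateSchwartz_apply (a : 𝔼) (f : 𝓢(𝔼, ℂ)) (x : 𝔼) : translateSchwartz a f x = f (x + a) := by
  rw [translateSchwartz, SchwartzMap.compSubConstCLM_apply, sub_neg_eq_add]

lemma eLpNorm_comp_add_right {f : 𝔼 → ℂ} (hf : Continuous f) (a : 𝔼) (p : ℝ≥0∞) :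
    eLpNorm (fun x => f (x + a)) p volume = eLpNorm f p volume :=
  eLpNorm_comp_measurePreserving hf.aestronglyMeasurable (measurePreserving_add_right volume a)

/-- A sum of translates of `f`. -/
def sumTranslates {N : ℕ} (σ : Fin N → 𝔼) (f : 𝓢(𝔼, ℂ)) : 𝓢(𝔼, ℂ) := ∑ j, translateSchwartz (σ j) f

lemma sumTranslates_apply {N : ℕ} (σ : Fin N → 𝔼) (f : 𝓢(𝔼, ℂ)) (x : 𝔼) :
    sumTranslates σ f x = ∑ j, f (x + σ j) := by
  simp [sumTranslates, translateSchwartz_apply]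

lemma disjoint_translates {N : ℕ} {σ : Fin N → 𝔼} (hσ : ∀ i j, i ≠ j → 2 ≤ ‖σ i - σ j‖)
    {F : 𝔼 → ℂ} (hF : ∀ x, 1 ≤ ‖x‖ → F x = 0) {i j : Fin N} (hij : i ≠ j) (x : 𝔼) :
    F (x + σ i) = 0 ∨ F (x + σ j) = 0 := by
  by_contra! h
  have h1 : ‖x + σ i‖ < 1 := not_le.1 fun hx => h.1 (hF _ hx)
  have h2 : ‖x + σ j‖ < 1 := not_le.1 fun hx => h.2 (hF _ hx)
  have h3 := norm_sub_le (x + σ i) (x + σ j)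
  rw [add_sub_add_left_eq_sub] at h3
  linarith [hσ i j hij]

lemma eLpNorm_sumTranslates_le {N : ℕ} {σ : Fin N → 𝔼} (hσ : ∀ i j, i ≠ j → 2 ≤ ‖σ i - σ j‖)
    {F : 𝓢(𝔼, ℂ)} (hF : ∀ x, 1 ≤ ‖x‖ → F x = 0) {q : ℝ≥0∞} (hq : q ≠ 0) :
    eLpNorm (sumTranslates σ F : 𝔼 → ℂ) q volume ≤
      (N : ℝ≥0∞) ^ (q⁻¹).toReal * eLpNorm (F : 𝔼 → ℂ) q volume := by
  have h := eLpNorm_sum_le_of_disjoint (μ := volume) (h := fun j x => F (x + σ j)) hq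
    (fun j => (F.continuous.comp (continuous_id.add continuous_const)).aestronglyMeasurable)
    (fun i j hij x => disjoint_translates hσ hF hij x)
    (fun j => eLpNorm_comp_add_right F.continuous (σ j) q)
  rw [Fintype.card_fin] at h
  rwa [show (sumTranslates σ F : 𝔼 → ℂ) = fun x => ∑ j, F (x + σ j) from
    funext (sumTranslates_apply σ F)]

/-- A sequence of symbols of bounded multiplier norm which, near the frequencies `(b k j, 0)` and
up to constants, converge to the symbols `(ξ, η) ↦ e^{2πi ⟨τ j, ξ - η⟩}` of the translations
`(f, g) ↦ f (· + τ j) g (· - τ j)`. -/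
structure TranslationLimit (n N : ℕ) (p q r K : ℝ≥0∞) where
  symbol : ℕ → EuclideanSpace ℝ (Fin n) → EuclideanSpace ℝ (Fin n) → ℂ
  freq : ℕ → Fin N → EuclideanSpace ℝ (Fin n)
  const : ℕ → Fin N → ℂ
  shift : Fin N → EuclideanSpace ℝ (Fin n)
  contractive : ∀ k, IsContractiveSymbol (symbol k)
  norm_le : ∀ k, bilinearMultiplierNorm p q r (symbol k) ≤ K
  norm_const : ∀ k j, ‖const k j‖ = 1
  tendsto : ∀ j ξ η, Tendsto (fun k => const k j * symbol k (ξ + freq k j) η) atTop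
    (𝓝 (planeWave (shift j) (ξ - η)))
  separated : ∀ i j, i ≠ j → 2 ≤ ‖shift i - shift j‖

namespace TranslationLimit

variable {N : ℕ} {p q r K : ℝ≥0∞} (T : TranslationLimit n N p q r K)

/-- The output of the localized symbol at the `j`-th frequency. -/
def piece (k : ℕ) (j : Fin N) (f g : 𝓢(𝔼, ℂ)) : 𝔼 → ℂ :=
  bilinearMultiplierOp (fun ξ η => T.const k j * T.symbol k (ξ + T.freq k j) η) f g

lemma continuous_piece (k : ℕ) (j : Fin N) (f g : 𝓢(𝔼, ℂ)) : Continuous (T.piece k j f g) :=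
  ((T.contractive k).const_mul_translate (T.norm_const k j) _).continuous_op f g

lemma tendsto_piece (j : Fin N) (f g : 𝓢(𝔼, ℂ)) (x : 𝔼) :
    Tendsto (fun k => T.piece k j f g x) atTop (𝓝 (f (x + T.shift j) * g (x - T.shift j))) := by
  rw [← bilinearMultiplierOp_shift]
  exact tendsto_bilinearMultiplierOp
    (fun k => (T.contractive k).const_mul_translate (T.norm_const k j) _)
    (isContractiveSymbol_shift _) (T.tendsto j) f g x

/-- A single application of the operator to a sum of modulated inputs produces all the localized
outputs together, with free coefficients $\varepsilon_j$ to be chosen later. -/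
lemma eLpNorm_sum_piece_le (hK : K ≠ ∞) (k : ℕ) (ε : Fin N → ℂ) (f : Fin N → 𝓢(𝔼, ℂ))
    (g : 𝓢(𝔼, ℂ)) :
    eLpNorm (fun x => ∑ j, ε j * (planeWave (T.freq k j) x * T.piece k j (f j) g x)) r volume ≤
      K * (eLpNorm (fun x => ∑ j, ε j * (T.const k j * planeWave (T.freq k j) x * f j x)) p volume
        * eLpNorm (g : 𝔼 → ℂ) q volume) := by
  set u : 𝓢(𝔼, ℂ) := ∑ j, (ε j * T.const k j) • modulate (T.freq k j) (f j) with hu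
  have h1 : (u : 𝔼 → ℂ) =
      fun x => ∑ j, ε j * (T.const k j * planeWave (T.freq k j) x * f j x) := by
    funext x
    simp [hu, modulate_apply, mul_assoc]
  have h2 : bilinearMultiplierOp (T.symbol k) u g =
      fun x => ∑ j, ε j * (planeWave (T.freq k j) x * T.piece k j (f j) g x) := by
    funext x
    rw [hu, (T.contractive k).op_sum_smul]
    refine Finset.sum_congr rfl fun j _ => ?_
    rw [bilinearMultiplierOp_modulate, piece, bilinearMultiplierOp_const_mul]
    ring
  have hne : bilinearMultiplierNorm p q r (T.symbol k) ≠ ∞ := ((T.norm_le k).trans_lt hK.lt_top).ne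
  rw [← h1, ← h2]
  exact (eLpNorm_op_le hne u g).trans (by gcongr; exact T.norm_le k)

/-- Superposed inputs are moved apart. -/
lemma card_rpow_mul_le_of_superposed (T : TranslationLimit n N p q r K) (hK : K ≠ ∞) (hq : q ≠ 0) (hr : r ≠ 0) (hr' : r ≠ ∞)
    (hp2 : p ≤ 2) {F : 𝓢(𝔼, ℂ)} (hF : ∀ x, 1 ≤ ‖x‖ → F x = 0) :
    (N : ℝ≥0∞) ^ (r⁻¹).toReal * eLpNorm (fun x => F x * F x) r volume ≤
      K * ((N : ℝ≥0∞) ^ (1 / 2 : ℝ) * eLpNorm (F : 𝔼 → ℂ) 2 volume *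
          volume (Metric.ball (0 : 𝔼) 1) ^ (1 / p.toReal - 1 / (2 : ℝ≥0∞).toReal) *
        ((N : ℝ≥0∞) ^ (q⁻¹).toReal * eLpNorm (F : 𝔼 → ℂ) q volume)) := by
  set τ := T.shift with hτ
  have hsep := T.separated
  have hsep2 : ∀ i j, i ≠ j → 2 ≤ ‖(2 : ℝ) • τ i - (2 : ℝ) • τ j‖ := fun i j hij => by
    rw [← smul_sub, norm_smul, Real.norm_two]
    linarith [hsep i j hij]
  -- The shifts are doubled so that $G(x-\tau_j)$ contains $F(x+\tau_j)$, matching the first factor;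
  -- the other translates miss its support.
  set G := sumTranslates (fun j => (2 : ℝ) • τ j) F with hG
  have hGle := eLpNorm_sumTranslates_le hsep2 hF hq
  set L : Fin N → 𝔼 → ℂ := fun j x => F (x + τ j) * F (x + τ j) with hL
  have hlim (j : Fin N) (x : 𝔼) : F (x + τ j) * G (x - τ j) = L j x := by
    rw [hG, sumTranslates_apply, Finset.mul_sum, Finset.sum_eq_single j _ (by simp), hL]
    · simp only
      congr 2
      rw [two_smul]; abel
    · intro i _ hij
      have h := disjoint_translates hsep2 hF hij (x - τ j)
      rw [show x - τ j + (2 : ℝ) • τ j = x + τ j by rw [two_smul]; abel] at h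
      rcases h with h | h
      · rw [h, mul_zero]
      · rw [h, zero_mul]
  have hLd : ∀ i j, i ≠ j → ∀ x, L i x = 0 ∨ L j x = 0 := fun i j hij x => by
    simpa [hL] using disjoint_translates hsep hF hij x
  have hFF : Continuous fun x => F x * F x := F.continuous.mul F.continuous
  have hLnorm : eLpNorm (fun x => ∑ j, L j x) r volume =
      (N : ℝ≥0∞) ^ (r⁻¹).toReal * eLpNorm (fun x => F x * F x) r volume := by
    have h := eLpNorm_sum_eq_of_disjoint (μ := volume) hr hr'
      (fun j => (hFF.comp (continuous_id.add continuous_const)).aestronglyMeasurable) hLd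
      (fun j => eLpNorm_comp_add_right hFF (τ j) r)
    rwa [Fintype.card_fin] at h
  have hv (k : ℕ) (j : Fin N) :
      Continuous fun x => T.const k j * planeWave (T.freq k j) x * F x :=
    (continuous_const.mul (continuous_planeWave continuous_const continuous_id)).mul F.continuous
  choose ε hε hεle using fun k => exists_unimodular_lintegral_sum_le (μ := volume) Finset.univ
    fun j => (hv k j).aestronglyMeasurable
  have hin (k : ℕ) :
      eLpNorm (fun x => ∑ j, ε k j * (T.const k j * planeWave (T.freq k j) x * F x)) p volume ≤
        (N : ℝ≥0∞) ^ (1 / 2 : ℝ) * eLpNorm (F : 𝔼 → ℂ) 2 volume *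
          volume (Metric.ball (0 : 𝔼) 1) ^ (1 / p.toReal - 1 / (2 : ℝ≥0∞).toReal) := by
    set u : 𝔼 → ℂ := fun x => ∑ j, ε k j * (T.const k j * planeWave (T.freq k j) x * F x) with hu
    have huc : Continuous u := continuous_finsetSum _ fun j _ => continuous_const.mul (hv k j)
    have hsupp : Function.support u ⊆ Metric.ball (0 : 𝔼) 1 := by
      intro x hx
      rw [mem_ball_zero_iff]
      by_contra! hx1
      exact hx (by simp [hu, hF x hx1])
    have h2 : eLpNorm u 2 volume ≤ (N : ℝ≥0∞) ^ (1 / 2 : ℝ) * eLpNorm (F : 𝔼 → ℂ) 2 volume := by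
      have hsq : eLpNorm u 2 volume ^ (2 : ℝ) ≤ N * eLpNorm (F : 𝔼 → ℂ) 2 volume ^ (2 : ℝ) := by
        rw [ENNReal.rpow_two, ENNReal.rpow_two, eLpNorm_two_sq, eLpNorm_two_sq]
        refine (hεle k).trans (le_of_eq ?_)
        simp [← ofReal_norm, T.norm_const, norm_planeWave]
      have := ENNReal.rpow_le_rpow hsq (by norm_num : (0 : ℝ) ≤ 1 / 2)
      rwa [ENNReal.mul_rpow_of_nonneg _ _ (by norm_num), ← ENNReal.rpow_mul, ← ENNReal.rpow_mul,
        mul_one_div_cancel two_ne_zero, ENNReal.rpow_one, ENNReal.rpow_one] at this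
    -- The input lives on the unit ball, so $p\le 2$ bounds its $L^p$ norm by its $L^2$ norm and a
    -- power of the volume.
    rw [← eLpNorm_restrict_eq_of_support_subset hsupp]
    refine (eLpNorm_le_eLpNorm_mul_rpow_measure_univ hp2 huc.aestronglyMeasurable).trans ?_
    rw [eLpNorm_restrict_eq_of_support_subset hsupp, Measure.restrict_apply_univ]
    gcongr
  have hout (k : ℕ) := (T.eLpNorm_sum_piece_le hK k (ε k) (fun _ => F) G).trans
    (show _ ≤ K * ((N : ℝ≥0∞) ^ (1 / 2 : ℝ) * eLpNorm (F : 𝔼 → ℂ) 2 volume *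
          volume (Metric.ball (0 : 𝔼) 1) ^ (1 / p.toReal - 1 / (2 : ℝ≥0∞).toReal) *
        ((N : ℝ≥0∞) ^ (q⁻¹).toReal * eLpNorm (F : 𝔼 → ℂ) q volume)) by gcongr; exact hin k)
  set Φ : ℕ → 𝔼 → ℂ := fun k x =>
    ∑ j, ε k j * (planeWave (T.freq k j) x * T.piece k j F G x) with hΦ
  have hΦc (k : ℕ) : Continuous (Φ k) := continuous_finsetSum _ fun j _ => continuous_const.mul
    ((continuous_planeWave continuous_const continuous_id).mul (T.continuous_piece k j F G))
  -- The signs and characters vary with $k$, so $\Phi_k$ itself need not converge. Its modulus does: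
  -- at each point at most one $L_j$ is nonzero, and unimodular factors do not affect it.
  have hconv (x : 𝔼) : Tendsto (fun k => ‖Φ k x‖) atTop (𝓝 ‖∑ j, L j x‖) := by
    have hn : ‖∑ j, L j x‖ = ∑ j, ‖L j x‖ :=
      apply_sum_of_disjoint _ norm_zero fun i j hij => hLd i j hij x
    have hn' (k : ℕ) : ‖∑ j, ε k j * (planeWave (T.freq k j) x * L j x)‖ = ‖∑ j, L j x‖ := by
      rw [hn, apply_sum_of_disjoint (fun z : ℂ => ‖z‖) norm_zero fun i j hij => ?_]
      · simp [hε, norm_planeWave]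
      · rcases hLd i j hij x with h | h <;> simp [h]
    have h0 : Tendsto (fun k => ∑ j, ‖T.piece k j F G x - L j x‖) atTop (𝓝 0) := by
      have : (0 : ℝ) = ∑ _j : Fin N, 0 := by simp
      rw [this]
      refine tendsto_finsetSum _ fun j _ => ?_
      rw [← tendsto_iff_norm_sub_tendsto_zero, ← hlim j x]
      exact T.tendsto_piece j F G x
    rw [tendsto_iff_norm_sub_tendsto_zero]
    refine squeeze_zero (fun _ => norm_nonneg _) (fun k => ?_) h0
    rw [← hn' k]
    refine (abs_norm_sub_norm_le _ _).trans ?_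
    rw [hΦ, ← Finset.sum_sub_distrib]
    refine (norm_sum_le _ _).trans (le_of_eq (Finset.sum_congr rfl fun j _ => ?_))
    rw [← mul_sub, ← mul_sub, norm_mul, norm_mul, hε, norm_planeWave, one_mul, one_mul]
  have hfatou := Lp.eLpNorm_lim_le_liminf_eLpNorm (p := r) (μ := (volume : Measure 𝔼))
    (f := fun k x => ‖Φ k x‖)
    (fun k => (hΦc k).norm.aestronglyMeasurable) (fun x => ‖∑ j, L j x‖)
    (Eventually.of_forall hconv)
  rw [← hLnorm, ← eLpNorm_norm]
  refine hfatou.trans ?_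
  refine (liminf_le_liminf (Eventually.of_forall fun k => ?_)).trans (liminf_const _).le
  rw [eLpNorm_norm]
  exact hout k

/-- Disjoint inputs are superposed. -/
lemma card_rpow_mul_le_of_disjoint (T : TranslationLimit n N p q r K) (hK : K ≠ ∞) (hp : p ≠ 0) (hq : q ≠ 0)
    (hr2 : 2 ≤ r) {F : 𝓢(𝔼, ℂ)} (hF : ∀ x, 1 ≤ ‖x‖ → F x = 0) :
    (N : ℝ≥0∞) ^ (1 / 2 : ℝ) * eLpNorm (fun x => F x * F x) 2 volume ≤
      K * (((N : ℝ≥0∞) ^ (p⁻¹).toReal * eLpNorm (F : 𝔼 → ℂ) p volume) *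
        ((N : ℝ≥0∞) ^ (q⁻¹).toReal * eLpNorm (F : 𝔼 → ℂ) q volume)) *
          volume (Metric.ball (0 : 𝔼) 1) ^ (1 / (2 : ℝ≥0∞).toReal - 1 / r.toReal) := by
  set τ := T.shift with hτ
  have hsep := T.separated
  have hsepn : ∀ i j, i ≠ j → 2 ≤ ‖-τ i - -τ j‖ := fun i j hij => by
    rw [← neg_sub', norm_neg]
    exact hsep i j hij
  set G := sumTranslates τ F with hG
  have hGle := eLpNorm_sumTranslates_le hsep hF hq
  -- The $j$-th bump is pre-shifted by $-\tau_j$, so that the limiting translation returns it to the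
  -- unit ball.
  set f : Fin N → 𝓢(𝔼, ℂ) := fun j => translateSchwartz (-τ j) F with hf
  have hlim (j : Fin N) (x : 𝔼) : f j (x + τ j) * G (x - τ j) = F x * F x := by
    have hfx : f j (x + τ j) = F x := by rw [hf]; simp [translateSchwartz_apply]
    rw [hfx, hG, sumTranslates_apply, Finset.mul_sum, Finset.sum_eq_single j _ (by simp)]
    · rw [sub_add_cancel]
    · intro i _ hij
      have h := disjoint_translates hsep hF hij (x - τ j)
      rw [sub_add_cancel] at h
      rcases h with h | h
      · rw [h, mul_zero]
      · rw [h, zero_mul]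
  have hw (k : ℕ) (j : Fin N) :
      Continuous fun x => planeWave (T.freq k j) x * T.piece k j (f j) G x :=
    (continuous_planeWave continuous_const continuous_id).mul (T.continuous_piece k j (f j) G)
  -- The signs are chosen for the outputs, on the ball only, where $r\ge 2$ allows $L^2$ to be
  -- controlled by $L^r$.
  choose ε hε hεle using fun k => exists_unimodular_le_lintegral_sum
    (μ := volume.restrict (Metric.ball (0 : 𝔼) 1)) Finset.univ
    fun j => (hw k j).aestronglyMeasurable
  have hin (k : ℕ) :
      eLpNorm (fun x => ∑ j, ε k j * (T.const k j * planeWave (T.freq k j) x * f j x)) p volume ≤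
        (N : ℝ≥0∞) ^ (p⁻¹).toReal * eLpNorm (F : 𝔼 → ℂ) p volume := by
    have h := eLpNorm_sum_le_of_disjoint (μ := volume)
      (h := fun j x => ε k j * (T.const k j * planeWave (T.freq k j) x * f j x)) hp
      (fun j => (continuous_const.mul ((continuous_const.mul
        (continuous_planeWave continuous_const continuous_id)).mul
          (f j).continuous)).aestronglyMeasurable)
      (fun i j hij x => ?_) (A := eLpNorm (F : 𝔼 → ℂ) p volume) (fun j => ?_)
    · rwa [Fintype.card_fin] at h
    · have h := disjoint_translates hsepn hF hij x
      rw [← translateSchwartz_apply, ← translateSchwartz_apply] at h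
      rcases h with h | h
      · exact Or.inl (by simp only [hf, h, mul_zero])
      · exact Or.inr (by simp only [hf, h, mul_zero])
    · rw [← eLpNorm_comp_add_right F.continuous (-τ j) p]
      refine eLpNorm_congr_norm_ae (Eventually.of_forall fun x => ?_)
      simp [hε, T.norm_const, norm_planeWave, hf, translateSchwartz_apply]
  set V := volume (Metric.ball (0 : 𝔼) 1) ^ (1 / (2 : ℝ≥0∞).toReal - 1 / r.toReal) with hV
  set R := K * (((N : ℝ≥0∞) ^ (p⁻¹).toReal * eLpNorm (F : 𝔼 → ℂ) p volume) *
        ((N : ℝ≥0∞) ^ (q⁻¹).toReal * eLpNorm (F : 𝔼 → ℂ) q volume)) with hR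
  have hout (k : ℕ) : ∫⁻ x in Metric.ball (0 : 𝔼) 1, ∑ j, ‖T.piece k j (f j) G x‖ₑ ^ 2 ≤
      (R * V) ^ 2 := by
    have h1 := (T.eLpNorm_sum_piece_le hK k (ε k) f G).trans
      (show _ ≤ R by rw [hR]; gcongr; exact hin k)
    set Φ : 𝔼 → ℂ := fun x => ∑ j, ε k j * (planeWave (T.freq k j) x * T.piece k j (f j) G x)
    have hΦc : Continuous Φ := continuous_finsetSum _ fun j _ => continuous_const.mul (hw k j)
    have h2 : eLpNorm Φ 2 (volume.restrict (Metric.ball (0 : 𝔼) 1)) ≤ R * V := by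
      refine (eLpNorm_le_eLpNorm_mul_rpow_measure_univ hr2 hΦc.aestronglyMeasurable).trans ?_
      rw [Measure.restrict_apply_univ]
      gcongr
      exact (eLpNorm_mono_measure _ Measure.restrict_le_self).trans h1
    rw [lintegral_finsetSum' _ fun j _ =>
      (T.continuous_piece k j (f j) G).aestronglyMeasurable.enorm.pow_const 2]
    have h3 := hεle k
    simp only [enorm_mul, enorm_planeWave, one_mul] at h3
    refine h3.trans ?_
    have h4 := pow_le_pow_left' h2 2
    rwa [eLpNorm_two_sq] at h4
  -- Each term of the square sum converges to $|F^2|^2$, because squaring moduli has removed the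
  -- signs and characters.
  have hfatou : ∫⁻ x in Metric.ball (0 : 𝔼) 1, (N : ℝ≥0∞) * ‖F x * F x‖ₑ ^ 2 ≤ (R * V) ^ 2 := by
    have hpt (x : 𝔼) : (N : ℝ≥0∞) * ‖F x * F x‖ₑ ^ 2 =
        liminf (fun k => ∑ j, ‖T.piece k j (f j) G x‖ₑ ^ 2) atTop := by
      have h : Tendsto (fun k => ∑ j, ‖T.piece k j (f j) G x‖ₑ ^ 2) atTop
          (𝓝 (∑ _j : Fin N, ‖F x * F x‖ₑ ^ 2)) := by
        refine tendsto_finsetSum _ fun j _ => ?_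
        rw [← hlim j x]
        exact ((ENNReal.continuous_pow 2).tendsto _).comp (T.tendsto_piece j (f j) G x).enorm
      rw [h.liminf_eq]
      simp
    simp only [hpt]
    refine (lintegral_liminf_le fun k => ?_).trans ?_
    · exact Finset.measurable_sum _ fun j _ =>
        (T.continuous_piece k j (f j) G).measurable.enorm.pow_const 2
    · exact (liminf_le_liminf (Eventually.of_forall hout)).trans (liminf_const _).le
  have hsupp : Function.support (fun x => F x * F x) ⊆ Metric.ball (0 : 𝔼) 1 := by
    intro x hx
    rw [mem_ball_zero_iff]
    by_contra! hx1
    exact hx (by simp [hF x hx1])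
  rw [lintegral_const_mul' _ _ (ENNReal.natCast_ne_top N), ← eLpNorm_two_sq,
    eLpNorm_restrict_eq_of_support_subset hsupp, ← ENNReal.rpow_two, ← ENNReal.rpow_two] at hfatou
  have := ENNReal.rpow_le_rpow hfatou (by norm_num : (0 : ℝ) ≤ 1 / 2)
  rwa [ENNReal.mul_rpow_of_nonneg _ _ (by norm_num), ← ENNReal.rpow_mul, ← ENNReal.rpow_mul,
    mul_one_div_cancel two_ne_zero, ENNReal.rpow_one, ENNReal.rpow_one] at this

end TranslationLimit

lemma eLpNorm_mul_self_ne_zero {F : 𝓢(𝔼, ℂ)} (hF : F 0 ≠ 0) {r : ℝ≥0∞} (hr : r ≠ 0) :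
    eLpNorm (fun x => F x * F x) r volume ≠ 0 := by
  have hc : Continuous fun x => F x * F x := F.continuous.mul F.continuous
  rw [Ne, eLpNorm_eq_zero_iff hc.aestronglyMeasurable hr]
  intro h
  have h0 := congrFun (hc.ae_eq_iff_eq volume continuous_zero |>.1 h) 0
  simp [hF] at h0

lemma volume_ball_rpow_ne_top (s : ℝ) : volume (Metric.ball (0 : 𝔼) 1) ^ s ≠ ∞ :=
  ENNReal.rpow_ne_top_of_ne_zero (Metric.measure_ball_pos volume _ one_pos).ne'
    measure_ball_lt_top.ne

lemma false_of_translationLimit {p q r K : ℝ≥0∞} (hp : p ≠ 0) (hq : q ≠ 0) (hr : r ≠ 0)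
    (hpqr : p⁻¹ + q⁻¹ = r⁻¹) (hout : p < 2 ∨ 2 < r) (hK : K ≠ ∞)
    (hT : ∀ N, Nonempty (TranslationLimit n N p q r K)) : False := by
  obtain ⟨F, hF, hF0⟩ := exists_schwartz_bump (n := n)
  have hexp : (r⁻¹).toReal = (p⁻¹).toReal + (q⁻¹).toReal := by
    rw [← hpqr, ENNReal.toReal_add (ENNReal.inv_ne_top.2 hp) (ENNReal.inv_ne_top.2 hq)]
  have hN0 {N : ℕ} (hN : 0 < N) : (N : ℝ≥0∞) ≠ 0 := by exact_mod_cast hN.ne'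
  rcases hout with hp2 | hr2
  -- The exact count for disjoint outputs needs $r<\infty$; $r=\infty$ would force $p=\infty$.
  · have hr' : r ≠ ∞ := by
      rintro rfl
      have h1 : p⁻¹ = 0 := by
        rw [ENNReal.inv_top] at hpqr
        exact (add_eq_zero.1 hpqr).1
      rw [ENNReal.inv_eq_zero] at h1
      rw [h1] at hp2
      exact absurd hp2 (by simp)
    have hlt : 1 / 2 + (q⁻¹).toReal < (r⁻¹).toReal := by
      have : (1 / 2 : ℝ) < (p⁻¹).toReal := by
        rw [one_div, ENNReal.toReal_inv]
        have h2 : p.toReal < 2 := by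
          simpa using (ENNReal.toReal_lt_toReal hp2.ne_top ENNReal.ofNat_ne_top).2 hp2
        exact (inv_lt_inv₀ two_pos (ENNReal.toReal_pos hp hp2.ne_top)).2 h2
      linarith
    refine false_of_natCast_rpow_le hlt (eLpNorm_mul_self_ne_zero hF0 hr)
      (B := K * (eLpNorm (F : 𝔼 → ℂ) 2 volume *
        volume (Metric.ball (0 : 𝔼) 1) ^ (1 / p.toReal - 1 / (2 : ℝ≥0∞).toReal) *
        eLpNorm (F : 𝔼 → ℂ) q volume)) ?_ fun N hN => ?_
    · exact ENNReal.mul_ne_top hK (ENNReal.mul_ne_top (ENNReal.mul_ne_top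
        (eLpNorm_schwartz_ne_top F 2) (volume_ball_rpow_ne_top _)) (eLpNorm_schwartz_ne_top F q))
    · obtain ⟨T⟩ := hT N
      refine (T.card_rpow_mul_le_of_superposed hK hq hr hr' hp2.le hF).trans (le_of_eq ?_)
      rw [ENNReal.rpow_add _ _ (hN0 hN) (ENNReal.natCast_ne_top N)]
      ring
  · have hlt : (p⁻¹).toReal + (q⁻¹).toReal < 1 / 2 := by
      rw [← hexp, one_div]
      have h : r⁻¹ < 2⁻¹ := ENNReal.inv_lt_inv.2 hr2
      simpa using (ENNReal.toReal_lt_toReal (ENNReal.inv_ne_top.2 hr) (by simp)).2 h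
    refine false_of_natCast_rpow_le hlt (eLpNorm_mul_self_ne_zero hF0 two_ne_zero)
      (B := K * (eLpNorm (F : 𝔼 → ℂ) p volume * eLpNorm (F : 𝔼 → ℂ) q volume) *
        volume (Metric.ball (0 : 𝔼) 1) ^ (1 / (2 : ℝ≥0∞).toReal - 1 / r.toReal)) ?_ fun N hN => ?_
    · exact ENNReal.mul_ne_top (ENNReal.mul_ne_top hK (ENNReal.mul_ne_top
        (eLpNorm_schwartz_ne_top F p) (eLpNorm_schwartz_ne_top F q))) (volume_ball_rpow_ne_top _)
    · obtain ⟨T⟩ := hT N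
      refine (T.card_rpow_mul_le_of_disjoint hK hp hq hr2.le hF).trans (le_of_eq ?_)
      rw [ENNReal.rpow_add _ _ (hN0 hN) (ENNReal.natCast_ne_top N)]
      ring

end Core

/-! ### Blowing up the phase, and the conclusion -/

section Main

variable {n : ℕ}

local notation "𝔼" => EuclideanSpace ℝ (Fin n)

lemma isContractiveSymbol_phase {ψ : 𝔼 → ℝ} (hψ : Continuous ψ) (lam : ℝ) :
    IsContractiveSymbol fun ξ η : 𝔼 => Complex.exp (Complex.I * (lam : ℂ) * (ψ (ξ - η) : ℂ)) := by
  refine ⟨by fun_prop, fun ξ η => ?_⟩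
  rw [show Complex.I * (lam : ℂ) * (ψ (ξ - η) : ℂ) = ((lam * ψ (ξ - η) : ℝ) : ℂ) * Complex.I by
    push_cast; ring, Complex.norm_exp_ofReal_mul_I]

/-- Magnifying the phase `lam * φ` at scale `lam⁻¹` near points with distinct gradients. -/
lemma exists_translationLimit {φ : 𝔼 → ℝ} (hφ : ContDiff ℝ 1 φ) (hnl : ¬ IsLinearPhase φ)
    {p q r K : ℝ≥0∞} (hp : 0 < p) (hq : 0 < q) (hpqr : p⁻¹ + q⁻¹ = r⁻¹)
    {lam : ℕ → ℝ} (hlam0 : ∀ k, lam k ≠ 0) (hlam : Tendsto (fun k => |lam k|) atTop atTop)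
    (hK : ∀ k, bilinearMultiplierNorm p q r (fun ξ η : 𝔼 =>
      Complex.exp (Complex.I * (lam k : ℂ) * (φ (ξ - η) : ℂ))) ≤ K) (N : ℕ) :
    Nonempty (TranslationLimit n N p q r K) := by
  obtain ⟨a, ha⟩ := exists_injective_gradient hφ hnl N
  obtain ⟨s, hs, hsep⟩ := exists_separating_dilation ha
  have hs0 : 2 * Real.pi * s ≠ 0 := by positivity
  -- The factor $\lambda_k^{-1}$ keeps the linear term of $\lambda_k\varphi$ of order one, $2\pi$
  -- matches the normalization of `planeWave`, and $s$ spreads the gradients to distance at least 2.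
  set t : ℕ → ℝ := fun k => (lam k)⁻¹ * (2 * Real.pi * s) with ht
  have ht0 (k : ℕ) : t k ≠ 0 := mul_ne_zero (inv_ne_zero (hlam0 k)) hs0
  have hcontr (k : ℕ) : IsContractiveSymbol fun ξ η : 𝔼 =>
      Complex.exp (Complex.I * (lam k : ℂ) * (φ (t k • ξ - t k • η) : ℂ)) := by
    have h := isContractiveSymbol_phase
      (hφ.continuous.comp (continuous_const_smul (t k))) (lam k)
    simpa only [Function.comp_apply, smul_sub] using h
  refine ⟨⟨fun k ξ η => Complex.exp (Complex.I * (lam k : ℂ) * (φ (t k • ξ - t k • η) : ℂ)),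
    fun k j => (t k)⁻¹ • a j,
    fun k j => Complex.exp ((-(lam k * φ (a j)) : ℝ) * Complex.I),
    fun j => s • gradient φ (a j), hcontr, fun k => ?_, fun k j => Complex.norm_exp_ofReal_mul_I _,
    fun j ξ η => ?_, hsep⟩⟩
  · exact (bilinearMultiplierNorm_comp_smul_le (m := fun ξ η : 𝔼 =>
      Complex.exp (Complex.I * (lam k : ℂ) * (φ (ξ - η) : ℂ))) hp hq hpqr (t k) (ht0 k)
      (hcontr k)).trans (hK k)
  · have hd : HasFDerivAt φ (innerSL ℝ (gradient φ (a j))) (a j) :=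
      ((hφ.differentiable one_ne_zero) (a j)).hasGradientAt.hasFDerivAt
    -- Differentiability at $a_j$ in sequential form:
    -- $\lambda_k(\varphi(a_j+\lambda_k^{-1}v)-\varphi(a_j))\to\langle\nabla\varphi(a_j),v\rangle$.
    have hlim := hd.lim ((2 * Real.pi * s) • (ξ - η)) hlam
    have hexp := (((Complex.continuous_ofReal.tendsto _).comp hlim).mul_const Complex.I).cexp
    have heq : Complex.exp (((innerSL ℝ (gradient φ (a j))) ((2 * Real.pi * s) • (ξ - η)) : ℝ) *
        Complex.I) = planeWave (s • gradient φ (a j)) (ξ - η) := by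
      rw [planeWave, innerSL_apply_apply, inner_smul_right, inner_smul_left]
      simp only [conj_trivial]
      push_cast
      ring_nf
    rw [heq] at hexp
    refine hexp.congr fun k => ?_
    have hpt : t k • (ξ + (t k)⁻¹ • a j) - t k • η =
        a j + (lam k)⁻¹ • (2 * Real.pi * s) • (ξ - η) := by
      rw [smul_add, smul_inv_smul₀ (ht0 k), smul_smul, smul_sub]
      abel
    rw [hpt, ← Complex.exp_add]
    simp only [Function.comp_apply, smul_eq_mul]
    push_cast
    ring_nf

lemma tendsto_bilinearMultiplierNorm_phase {φ : 𝔼 → ℝ} (hφ : ContDiff ℝ 1 φ)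
    (hnl : ¬ IsLinearPhase φ) {p q r : ℝ≥0∞} (hp : 0 < p) (hq : 0 < q) (hr : 0 < r)
    (hpqr : p⁻¹ + q⁻¹ = r⁻¹) (hout : p < 2 ∨ 2 < r) :
    Tendsto (fun lam : ℝ => bilinearMultiplierNorm p q r (fun ξ η : 𝔼 =>
      Complex.exp (Complex.I * (lam : ℂ) * (φ (ξ - η) : ℂ))))
      (comap (fun lam : ℝ => |lam|) atTop) (𝓝 ∞) := by
  rw [ENNReal.tendsto_nhds_top_iff_nnreal]
  -- Failure of divergence gives a finite bound $K$ only for frequently many $\lambda$; a sequence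
  -- with $|\lambda_k|\to\infty$ is extracted from these.
  by_contra! hcon
  obtain ⟨K, hK⟩ := hcon
  have hne : ∀ᶠ lam : ℝ in comap (fun lam : ℝ => |lam|) atTop, lam ≠ 0 := by
    filter_upwards [tendsto_comap.eventually (eventually_gt_atTop (0 : ℝ))] with lam h
    exact abs_pos.1 h
  obtain ⟨lam, hlam, h⟩ := exists_seq_forall_of_frequently
    (hK.and_eventually hne)
  exact false_of_translationLimit hp.ne' hq.ne' hr.ne' hpqr hout ENNReal.coe_ne_top
    (exists_translationLimit hφ hnl hp hq hpqr (fun k => (h k).2) (tendsto_comap.comp hlam)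
      fun k => (h k).1)

lemma two_lt_of_conjExponent_lt_two {r : ℝ≥0∞} (h : ENNReal.conjExponent r < 2) : 2 < r := by
  rw [ENNReal.conjExponent, ← one_add_one_eq_two,
    ENNReal.add_lt_add_iff_left ENNReal.one_ne_top] at h
  have h1 : 1 < r - 1 := by simpa using ENNReal.inv_lt_inv.1 (h.trans_eq inv_one.symm)
  rw [← one_add_one_eq_two]
  exact lt_tsub_iff_right.1 h1

lemma IsLinearPhase.of_comp_neg {φ : 𝔼 → ℝ} (h : IsLinearPhase fun t => φ (-t)) :
    IsLinearPhase φ := by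
  obtain ⟨α, β, h⟩ := h
  refine ⟨-α, β, fun t => ?_⟩
  have := h (-t)
  simp only [neg_neg] at this
  rw [this, inner_neg_left, inner_neg_right]

end Main

end

theorem theorem2p1 (n : ℕ) (p q r : ℝ≥0∞) (hp : 0 < p) (hq : 0 < q) (hr : 0 < r)
    (hpqr : p⁻¹ + q⁻¹ = r⁻¹) (hout : ¬ InLocalL2Range p q r)
    (φ : EuclideanSpace ℝ (Fin n) → ℝ) (hφ : ContDiff ℝ 1 φ) (hnl : ¬ IsLinearPhase φ) :
    Filter.Tendsto
      (fun lam : ℝ => bilinearMultiplierNorm p q r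
        (fun ξ η : EuclideanSpace ℝ (Fin n) =>
          Complex.exp (Complex.I * (lam : ℂ) * (φ (ξ - η) : ℂ))))
      (Filter.comap (fun lam : ℝ => |lam|) Filter.atTop) (nhds (⊤ : ℝ≥0∞)) := by
  by_cases hout' : p < 2 ∨ 2 < r
  · exact tendsto_bilinearMultiplierNorm_phase hφ hnl hp hq hr hpqr hout'
  push Not at hout'
  have hq2 : q < 2 := by
    by_contra! hq2
    exact hout ⟨hpqr, hout'.1, hq2,
      not_lt.1 fun h => hout'.2.not_gt (two_lt_of_conjExponent_lt_two h)⟩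
  -- Only $q<2$ remains. Exchanging the inputs replaces $\varphi(\xi-\eta)$ by $\varphi(\eta-\xi)$,
  -- that is, the phase by its reflection.
  have hψ : ContDiff ℝ 1 fun t => φ (-t) := hφ.comp contDiff_neg
  have h := tendsto_bilinearMultiplierNorm_phase hψ (fun hl => hnl hl.of_comp_neg) hq hp hr
    ((add_comm _ _).trans hpqr) (Or.inl hq2)
  refine h.congr fun lam => ?_
  rw [← (isContractiveSymbol_phase hφ.continuous lam).norm_swap p q r]
  simp only [neg_sub]
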